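/- Let $\mathsf Y$ be a standard Borel space with a probability measure $\mu$, and let $\mathsf U$ be a locally compact Borel space (equivalently, a locally compact, separable, metrizable space) with its Borel $\sigma$-algebra. Let $k:\mathsf U\times\mathsf U\to\mathbb R$ be a positive semi-definite kernel with reproducing kernel Hilbert space $\mathcal H_k$, and assume that $k$ is bounded and continuous, that $k(\cdot,u)\in C_0(\mathsf U)$ for all $u\in\mathsf U$, and that $\mathcal H_k$ is dense in $C_0(\mathsf U)$ for the supremum norm. For a probability measure $\nu$ on $\mathsf U$ let $I_\nu=\int_{\mathsf U}k(\cdot,u)\,\nu(du)\in\mathcal H_k$ (Bochner integral). Let $\Gamma$ be the set of stochastic kernels from $\mathsf Y$ to $\mathsf U$, and for $1\le p<\infty$ define three topologies on $\Gamma$: * the weak kernel mean embedding topology is the smallest topology for which $\gamma\mapsto\int_{\mathsf Y}\langle I_{\gamma(y)},f(y)\rangle_{\mathcal H_k}\,\mu(dy)$ is continuous for every $f\in L_p(\mu,\mathcal H_k)$; * the $w^*$- (Borkar) topology is the smallest topology for which $\gamma\mapsto\int_{\mathsf Y}\int_{\mathsf U}f(y)(u)\,\gamma(y)(du)\,\mu(dy)$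 is continuous for every $f\in L_p(\mu,C_0(\mathsf U))$; * the Young narrow topology is the smallest topology for which $\gamma\mapsto\int_{\mathsf Y}\int_{\mathsf U}h(y,u)\,\gamma(y)(du)\,\mu(dy)$ is continuous for every $C_b$-Carathéodory function $h$ (that is, $h:\mathsf Y\times\mathsf U\to\mathbb R$ is measurable and $h(y,\cdot)\in C_b(\mathsf U)$ for all $y$) with $\int_{\mathsf Y}\sup_{u}|h(y,u)|^p\,\mu(dy)<\infty$. Let $(\gamma_\lambda)$ be a sequence in $\Gamma$ and let $\gamma\in\Gamma$. Then, for any choice of the exponent $p\in[1,\infty)$ in each of the three topologies (not necessarily the same one), the following are equivalent: (i) $\gamma_\lambda\to\gamma$ in the weak kernel mean embedding topology; (ii) $\gamma_\lambda\to\gamma$ in the $w^*$-topology; (iii) $\gamma_\lambda\to\gamma$ in the Young narrow topology. -/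

import Mathlib

open MeasureTheory ProbabilityTheory Filter Topology
open scoped ENNReal ZeroAtInfty BoundedContinuousFunction

/-- The set `Γ` of stochastic kernels from `Y` to `U`. -/
abbrev StochasticKernel (Y U : Type*) [MeasurableSpace Y] [MeasurableSpace U] : Type _ :=
  {γ : Kernel Y U // IsMarkovKernel γ}

section RKHS

variable {U : Type*} (H : Type*) [NormedAddCommGroup H] [InnerProductSpace ℝ H] [CompleteSpace H]
  [RKHS ℝ H U ℝ]

/-- `H` is the reproducing kernel Hilbert space of the real-valued kernel `k`
(Mathlib's kernel of `H` takes values in the continuous linear maps `ℝ →L[ℝ] ℝ`). -/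
def IsRKHSOf (k : U → U → ℝ) : Prop :=
  ∀ u v : U, RKHS.kernel H u v 1 = k u v

/-- The feature map `Φ(u) = k(·, u) ∈ H`. -/
noncomputable def featureMap (u : U) : H :=
  RKHS.kerFun H u (1 : ℝ)

/-- The kernel mean embedding `I_ν = ∫ k(·, u) ν(du)`, a Bochner integral in `H`. -/
noncomputable def kernelMeanEmbedding [MeasurableSpace U] (ν : Measure U) : H :=
  ∫ u, featureMap H u ∂ν

/-- The conditions imposed on the kernel `k` and on its reproducing kernel Hilbert space `H`. -/
structure KernelAssumption [TopologicalSpace U] (k : U → U → ℝ) : Prop where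
  /-- `k` is bounded. -/
  bounded : ∃ M : ℝ, ∀ u v : U, |k u v| ≤ M
  /-- `k` is (jointly) continuous. -/
  continuous : Continuous fun x : U × U => k x.1 x.2
  /-- `k(·, u)` belongs to `C₀(U)` for every `u`. -/
  zeroAtInfty : ∀ u : U, ∃ g : C₀(U, ℝ), ∀ v : U, g v = k v u
  /-- `H`, as a set of functions, is dense in `C₀(U)` for the supremum norm. -/
  dense : Dense {g : C₀(U, ℝ) | ∃ h : H, ∀ u : U, g u = h u}

end RKHS

section Topologies

variable {Y U : Type*} [MeasurableSpace Y] [MeasurableSpace U]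

/-- The weak kernel mean embedding topology on `Γ` at input `μ`: the smallest topology making
`γ ↦ ∫ ⟪I_{γ(y)}, f(y)⟫ μ(dy)` continuous for every `f ∈ L_p(μ, H)`. -/
@[reducible]
noncomputable def weakKMETopology (H : Type*) [NormedAddCommGroup H] [InnerProductSpace ℝ H]
    [CompleteSpace H] [RKHS ℝ H U ℝ] (μ : Measure Y) (p : ℝ≥0∞) :
    TopologicalSpace (StochasticKernel Y U) :=
  ⨅ f : {f : Y → H // MemLp f p μ},
    TopologicalSpace.induced
      (fun γ : StochasticKernel Y U =>
        ∫ y, inner ℝ (kernelMeanEmbedding H (γ.1 y)) (f.1 y) ∂μ)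
      inferInstance

/-- The `w*` (Borkar) topology on `Γ` at input `μ`: the smallest topology making
`γ ↦ ∫∫ f(y)(u) γ(y)(du) μ(dy)` continuous for every `f ∈ L_p(μ, C₀(U))`. -/
@[reducible]
noncomputable def wStarTopology [TopologicalSpace U] (μ : Measure Y) (p : ℝ≥0∞) :
    TopologicalSpace (StochasticKernel Y U) :=
  ⨅ f : {f : Y → C₀(U, ℝ) // MemLp f p μ},
    TopologicalSpace.induced
      (fun γ : StochasticKernel Y U => ∫ y, ∫ u, f.1 y u ∂(γ.1 y) ∂μ)
      inferInstance

/-- `h` is a `C_b`-Carathéodory function (jointly measurable, with `h(y, ·) ∈ C_b(U)` for all `y`)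
whose norm `y ↦ ‖h(y, ·)‖_∞` is `p`-integrable. -/
def IsCbCaratheodory [TopologicalSpace U] (μ : Measure Y) (p : ℝ≥0∞) (h : Y → U →ᵇ ℝ) : Prop :=
  (Measurable fun x : Y × U => h x.1 x.2) ∧ eLpNorm h p μ < ∞

/-- The Young narrow topology on `Γ` at input `μ`: the smallest topology making
`γ ↦ ∫∫ h(y, u) γ(y)(du) μ(dy)` continuous for every `p`-integrable `C_b`-Carathéodory
function `h`. -/
@[reducible]
noncomputable def youngNarrowTopology [TopologicalSpace U] (μ : Measure Y) (p : ℝ≥0∞) :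
    TopologicalSpace (StochasticKernel Y U) :=
  ⨅ h : {h : Y → U →ᵇ ℝ // IsCbCaratheodory μ p h},
    TopologicalSpace.induced
      (fun γ : StochasticKernel Y U => ∫ y, ∫ u, h.1 y u ∂(γ.1 y) ∂μ)
      inferInstance

end Topologies

section Approximation

/-! Each of the three convergences is equivalent to one condition that involves neither `p` nor `H`:
for every `g ∈ C₀(U)` and measurable `A ⊆ Y`, the integrals `∫_A ∫ g dγ_n dμ` converge to `∫_A ∫ g
dγ dμ`.

A stochastic kernel is a uniformly bounded measurable field of functionals, both on `C₀(U)` and,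
through the mean embedding, on `H`. For such fields, testing on `L^p` sections amounts to testing on
sections `1_A e`, as simple functions are dense in `L¹ ⊇ L^p`
(`forall_memLp_tendsto_iff_setwiseTendsto`). This settles `w*`. For the mean embedding,
`SetwiseTendsto.of_dense_span` passes between `H` and `C₀(U)`: `H` is dense in `C₀(U)`, and the
functions `k(·, u)` lie in `C₀(U)` and span a dense subspace of `H`.

For the Young topology, a Carathéodory `h` is cut off to a section of `C₀(U)`. The error is bounded
by the `‖h‖`-weighted mass outside the cutoff, which is itself given by a `C₀` pairing and so
converges. Since the limit is a probability kernel, no mass escapes to infinity. -/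

theorem tendsto_of_forall_approx {a : ℕ → ℝ} {a' : ℝ}
    (h : ∀ ε > 0, ∃ (b : ℕ → ℝ) (b' : ℝ), Tendsto b atTop (𝓝 b') ∧
      (∀ᶠ n in atTop, |a n - b n| ≤ ε) ∧ |a' - b'| ≤ ε) :
    Tendsto a atTop (𝓝 a') := by
  rw [Metric.tendsto_nhds]
  intro ε hε
  obtain ⟨b, b', hb, hab, hab'⟩ := h (ε / 4) (by positivity)
  filter_upwards [hab, Metric.tendsto_nhds.1 hb (ε / 4) (by positivity)] with n h1 h2
  rw [Real.dist_eq, abs_lt] at *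
  rw [abs_le] at *
  constructor <;> linarith [h1.1, h1.2, h2.1, h2.2, hab'.1, hab'.2]

theorem tendsto_nhds_iInf_induced {X ι κ : Type*} {Z : ι → Type*} [∀ i, TopologicalSpace (Z i)]
    (F : ∀ i, X → Z i) (u : κ → X) (l : Filter κ) (x : X) :
    Tendsto u l (@nhds X (⨅ i, TopologicalSpace.induced (F i) inferInstance) x) ↔
      ∀ i, Tendsto (fun n => F i (u n)) l (𝓝 (F i x)) := by
  simp only [nhds_iInf, nhds_induced, tendsto_iInf, tendsto_comap_iff, Function.comp_def]

end Approximation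

/-! ### Bounded measurable fields of functionals on a normed space. -/

section FunctionalFields

variable {Y E : Type*} [MeasurableSpace Y] {μ : Measure Y}
  [NormedAddCommGroup E] [NormedSpace ℝ E]

/-- `T` is measurable only at each fixed vector, not in operator norm; simple functions reduce to
fixed vectors, and continuity of each `T y` gives the limit. -/
theorem aestronglyMeasurable_clm_apply {T : Y → E →L[ℝ] ℝ}
    (hT : ∀ e, StronglyMeasurable fun y => T y e) {f : Y → E} (hf : AEStronglyMeasurable f μ) :
    AEStronglyMeasurable (fun y => T y (f y)) μ := by
  obtain ⟨f', hf', hff'⟩ := hf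
  have hs : ∀ s : SimpleFunc Y E, StronglyMeasurable fun y => T y (s y) := by
    intro s
    induction s using SimpleFunc.induction with
    | const c hA =>
      rename_i A
      have : (fun y => T y ((SimpleFunc.piecewise A hA (SimpleFunc.const Y c)
          (SimpleFunc.const Y 0)) y)) = A.indicator fun y => T y c := by
        classical
        ext y
        by_cases hy : y ∈ A <;> simp [hy]
      rw [this]
      exact (hT c).indicator hA
    | add _ h1 h2 =>
      simp only [SimpleFunc.coe_add, Pi.add_apply, map_add]
      exact h1.add h2
  refine ⟨fun y => T y (f' y), ?_, ?_⟩
  · refine stronglyMeasurable_of_tendsto atTop (fun n => hs (hf'.approx n)) ?_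
    rw [tendsto_pi_nhds]
    exact fun y => ((T y).continuous.tendsto _).comp (hf'.tendsto_approx y)
  · filter_upwards [hff'] with y hy
    rw [hy]

theorem integrable_clm_apply {T : Y → E →L[ℝ] ℝ} {C : ℝ}
    (hT : ∀ e, StronglyMeasurable fun y => T y e) (hC : ∀ y, ‖T y‖ ≤ C)
    {f : Y → E} (hf : Integrable f μ) : Integrable (fun y => T y (f y)) μ :=
  (hf.norm.const_mul C).mono' (aestronglyMeasurable_clm_apply hT hf.1)
    (.of_forall fun y => (T y).le_of_opNorm_le (hC y) _)

theorem abs_integral_clm_apply_sub_le {T : Y → E →L[ℝ] ℝ} {C : ℝ}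
    (hT : ∀ e, StronglyMeasurable fun y => T y e) (hC : ∀ y, ‖T y‖ ≤ C)
    {f g : Y → E} (hf : Integrable f μ) (hg : Integrable g μ) :
    |(∫ y, T y (f y) ∂μ) - ∫ y, T y (g y) ∂μ| ≤ C * ∫ y, ‖f y - g y‖ ∂μ := by
  rw [← integral_sub (integrable_clm_apply hT hC hf) (integrable_clm_apply hT hC hg),
    ← integral_const_mul, ← Real.norm_eq_abs]
  refine norm_integral_le_of_norm_le ((hf.sub hg).norm.const_mul C) (.of_forall fun y => ?_)
  rw [← map_sub]
  exact (T y).le_of_opNorm_le (hC y) _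

/-- Convergence of the functionals `T n y` to `T' y` at the vector `e`, in the mean over every
measurable set of parameters `y`. -/
def SetwiseTendsto (μ : Measure Y) (T : ℕ → Y → E →L[ℝ] ℝ) (T' : Y → E →L[ℝ] ℝ) (e : E) : Prop :=
  ∀ A : Set Y, MeasurableSet A →
    Tendsto (fun n => ∫ y in A, T n y e ∂μ) atTop (𝓝 (∫ y in A, T' y e ∂μ))

variable {T : ℕ → Y → E →L[ℝ] ℝ} {T' : Y → E →L[ℝ] ℝ} {C : ℝ}

/-- The bound `C` makes the maps `e ↦ ∫_A T n y e` equi-Lipschitz, so convergence extends from the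
span to its closure. -/
theorem SetwiseTendsto.of_dense_span [IsFiniteMeasure μ]
    (hT : ∀ n e, StronglyMeasurable fun y => T n y e)
    (hT' : ∀ e, StronglyMeasurable fun y => T' y e)
    (hC : ∀ n y, ‖T n y‖ ≤ C) (hC' : ∀ y, ‖T' y‖ ≤ C) {S : Set E}
    (hS : Dense (Submodule.span ℝ S : Set E)) (h : ∀ e ∈ S, SetwiseTendsto μ T T' e) (e : E) :
    SetwiseTendsto μ T T' e := by
  have hint : ∀ n e (A : Set Y), Integrable (fun y => T n y e) (μ.restrict A) := fun n e A =>
    integrable_clm_apply (hT n) (hC n) (integrable_const e)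
  have hint' : ∀ e (A : Set Y), Integrable (fun y => T' y e) (μ.restrict A) := fun e A =>
    integrable_clm_apply hT' hC' (integrable_const e)
  have hspan : ∀ e ∈ Submodule.span ℝ S, SetwiseTendsto μ T T' e := by
    intro e he
    induction he using Submodule.span_induction with
    | mem e he => exact h e he
    | zero => intro A _; simp
    | add e₁ e₂ _ _ h₁ h₂ =>
      intro A hA
      simp only [map_add]
      simpa only [integral_add (hint _ _ _) (hint _ _ _), integral_add (hint' _ _) (hint' _ _)]
        using (h₁ A hA).add (h₂ A hA)
    | smul c e _ h₁ =>
      intro A hA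
      simpa only [map_smul, smul_eq_mul, integral_const_mul] using (h₁ A hA).const_mul c
  intro A hA
  refine tendsto_of_forall_approx fun ε hε => ?_
  -- A common Lipschitz constant; the `+ 1` keeps it positive when `A` is null or `C = 0`.
  set D := |C| * μ.real A + 1 with hD
  have hD0 : 0 < D := by positivity
  obtain ⟨e', he', hlt⟩ := Metric.dense_iff.1 hS e (ε / D) (by positivity)
  have key : ∀ R : Y → E →L[ℝ] ℝ, (∀ e, StronglyMeasurable fun y => R y e) → (∀ y, ‖R y‖ ≤ C) →
      |(∫ y in A, R y e ∂μ) - ∫ y in A, R y e' ∂μ| ≤ ε := by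
    intro R hR hRC
    refine (abs_integral_clm_apply_sub_le hR hRC (integrable_const e)
      (integrable_const e')).trans ?_
    have h1 : ‖e - e'‖ ≤ ε / D := by
      rw [← dist_eq_norm, dist_comm]
      exact (Metric.mem_ball.1 he').le
    calc C * ∫ y in A, ‖e - e'‖ ∂μ = C * μ.real A * ‖e - e'‖ := by simp; ring
      _ ≤ D * ‖e - e'‖ := by
        gcongr
        have := mul_le_mul_of_nonneg_right (le_abs_self C) (measureReal_nonneg (μ := μ) (s := A))
        linarith
      _ ≤ D * (ε / D) := by gcongr
      _ = ε := by field_simp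
  exact ⟨_, _, hspan e' hlt A hA, .of_forall fun n => key _ (hT n) (hC n), key _ hT' hC'⟩

theorem tendsto_integral_of_setwiseTendsto (hT : ∀ n e, StronglyMeasurable fun y => T n y e)
    (hT' : ∀ e, StronglyMeasurable fun y => T' y e)
    (hC : ∀ n y, ‖T n y‖ ≤ C) (hC' : ∀ y, ‖T' y‖ ≤ C)
    (h : ∀ e, SetwiseTendsto μ T T' e) {f : Y → E} (hf : Integrable f μ) :
    Tendsto (fun n => ∫ y, T n y (f y) ∂μ) atTop (𝓝 (∫ y, T' y (f y) ∂μ)) := by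
  refine Integrable.induction (P := fun f => Tendsto (fun n => ∫ y, T n y (f y) ∂μ) atTop
    (𝓝 (∫ y, T' y (f y) ∂μ))) ?_ ?_ ?_ ?_ hf
  · intro c A hA _
    have : ∀ R : Y → E →L[ℝ] ℝ, ∫ y, R y (A.indicator (fun _ => c) y) ∂μ = ∫ y in A, R y c ∂μ := by
      intro R
      rw [← integral_indicator hA]
      congr with y
      by_cases hy : y ∈ A <;> simp [hy]
    simpa only [this] using h c A hA
  · intro f g _ hf hg h1 h2
    simp only [Pi.add_apply, map_add]
    rw [integral_add (integrable_clm_apply hT' hC' hf) (integrable_clm_apply hT' hC' hg)]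
    refine (h1.add h2).congr fun n => ?_
    rw [integral_add (integrable_clm_apply (hT n) (hC n) hf)
      (integrable_clm_apply (hT n) (hC n) hg)]
  -- Closedness in `L¹`: the bound `C` makes the approximation error uniform in `n`.
  · rw [← isSeqClosed_iff_isClosed]
    intro f g hf hfg
    refine tendsto_of_forall_approx fun ε hε => ?_
    obtain ⟨m, hm⟩ := (Metric.tendsto_atTop.1 hfg (ε / (|C| + 1)) (by positivity))
    have key : ∀ R : Y → E →L[ℝ] ℝ, (∀ e, StronglyMeasurable fun y => R y e) →
        (∀ y, ‖R y‖ ≤ C) → |(∫ y, R y (g y) ∂μ) - ∫ y, R y (f m y) ∂μ| ≤ ε := by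
      intro R hR hRC
      refine (abs_integral_clm_apply_sub_le hR hRC (L1.integrable_coeFn g)
        (L1.integrable_coeFn (f m))).trans ?_
      have h1 := (hm m le_rfl).le
      rw [dist_comm, L1.dist_eq_integral_dist] at h1
      simp only [dist_eq_norm] at h1
      calc C * ∫ y, ‖g y - f m y‖ ∂μ ≤ (|C| + 1) * ∫ y, ‖g y - f m y‖ ∂μ := by
            gcongr
            linarith [le_abs_self C]
        _ ≤ (|C| + 1) * (ε / (|C| + 1)) := by gcongr
        _ = ε := by field_simp
    exact ⟨_, _, hf m, .of_forall fun n => key _ (hT n) (hC n), key _ hT' hC'⟩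
  · intro f g hfg _ h1
    have : ∀ R : Y → E →L[ℝ] ℝ, ∫ y, R y (f y) ∂μ = ∫ y, R y (g y) ∂μ := fun R =>
      integral_congr_ae (hfg.mono fun y hy => congrArg (R y) hy)
    simpa only [this] using h1

/-- For uniformly bounded measurable fields of functionals, convergence on the `L^p` sections is
the same as setwise convergence at every vector. -/
theorem forall_memLp_tendsto_iff_setwiseTendsto [IsFiniteMeasure μ]
    (hT : ∀ n e, StronglyMeasurable fun y => T n y e)
    (hT' : ∀ e, StronglyMeasurable fun y => T' y e)
    (hC : ∀ n y, ‖T n y‖ ≤ C) (hC' : ∀ y, ‖T' y‖ ≤ C) {p : ℝ≥0∞} (hp : 1 ≤ p) :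
    (∀ f : Y → E, MemLp f p μ →
      Tendsto (fun n => ∫ y, T n y (f y) ∂μ) atTop (𝓝 (∫ y, T' y (f y) ∂μ))) ↔
      ∀ e, SetwiseTendsto μ T T' e := by
  refine ⟨fun h e A hA => ?_, fun h f hf =>
    tendsto_integral_of_setwiseTendsto hT hT' hC hC' h (hf.integrable hp)⟩
  have : ∀ R : Y → E →L[ℝ] ℝ, ∫ y in A, R y e ∂μ = ∫ y, R y (A.indicator (fun _ => e) y) ∂μ := by
    intro R
    rw [← integral_indicator hA]
    congr with y
    by_cases hy : y ∈ A <;> simp [hy]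
  simpa only [this] using h _ ((memLp_const e).indicator hA)

end FunctionalFields

/-! ### Functionals on `C₀(U)` and cutoffs. -/

section VanishingAtInfinity

variable {U : Type*} [TopologicalSpace U]

theorem integrable_zeroAtInfty [MeasurableSpace U] [OpensMeasurableSpace U] (ν : Measure U)
    [IsFiniteMeasure ν] (g : C₀(U, ℝ)) : Integrable g ν :=
  (BoundedContinuousFunction.integrable ν g.toBCF :)

theorem norm_zeroAtInfty_apply_le (g : C₀(U, ℝ)) (u : U) : ‖g u‖ ≤ ‖g‖ := by
  rw [← ZeroAtInftyContinuousMap.norm_toBCF_eq_norm]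
  exact g.toBCF.norm_coe_le_norm u

/-- Integration against a probability measure, as a continuous linear functional on `C₀`. -/
noncomputable def zeroAtInftyIntegral [MeasurableSpace U] [OpensMeasurableSpace U] (ν : Measure U)
    [IsProbabilityMeasure ν] : C₀(U, ℝ) →L[ℝ] ℝ :=
  LinearMap.mkContinuous
    { toFun := fun g => ∫ u, g u ∂ν
      map_add' := fun f g =>
        integral_add (integrable_zeroAtInfty ν f) (integrable_zeroAtInfty ν g)
      map_smul' := fun c g => integral_const_mul c _ } 1 fun g => by
    simpa using norm_integral_le_of_norm_le_const (μ := ν)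
      (.of_forall fun u => norm_zeroAtInfty_apply_le g u)

theorem norm_zeroAtInftyIntegral_le [MeasurableSpace U] [OpensMeasurableSpace U] (ν : Measure U)
    [IsProbabilityMeasure ν] : ‖zeroAtInftyIntegral ν‖ ≤ 1 :=
  LinearMap.mkContinuous_norm_le _ zero_le_one _

/-- Multiplication of a continuous function by a compactly supported one. -/
noncomputable def cutoff (g : C(U, ℝ)) (hg : HasCompactSupport g) (φ : C(U, ℝ)) : C₀(U, ℝ) where
  toContinuousMap := φ * g
  zero_at_infty' := (hg.mul_left (f := φ)).is_zero_at_infty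

theorem cutoff_apply (g : C(U, ℝ)) (hg : HasCompactSupport g) (φ : C(U, ℝ)) (u : U) :
    cutoff g hg φ u = φ u * g u := rfl

/-- Only uniform convergence on the compact support of `g` matters, which the compact-open topology
provides. -/
theorem continuous_cutoff (g : C(U, ℝ)) (hg : HasCompactSupport g) :
    Continuous (cutoff g hg) := by
  rw [continuous_iff_continuousAt]
  intro φ
  rw [ContinuousAt, ZeroAtInftyContinuousMap.tendsto_iff_tendstoUniformly,
    Metric.tendstoUniformly_iff]
  intro ε hε
  obtain ⟨M, hM⟩ := hg.exists_bound_of_continuous g.continuous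
  have hφ := ContinuousMap.tendsto_iff_forall_isCompact_tendstoUniformlyOn.1
    (tendsto_id (x := 𝓝 φ)) (tsupport g) hg
  rw [Metric.tendstoUniformlyOn_iff] at hφ
  filter_upwards [hφ (ε / (|M| + 1)) (by positivity)] with ψ hψ u
  by_cases hu : u ∈ tsupport g
  · rw [cutoff_apply, cutoff_apply, Real.dist_eq, ← sub_mul, abs_mul]
    have h1 := hψ u hu
    rw [Real.dist_eq] at h1
    calc |φ u - ψ u| * |g u| ≤ |φ u - ψ u| * (|M| + 1) := by
          gcongr
          linarith [hM u, Real.norm_eq_abs (g u), le_abs_self M]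
      _ < ε / (|M| + 1) * (|M| + 1) := by
          gcongr
          exact h1
      _ = ε := by field_simp
  · simpa [cutoff_apply, image_eq_zero_of_notMem_tsupport hu] using hε

end VanishingAtInfinity

/-! ### Measurability of function-valued maps. -/

section MeasurableFunctionValued

variable {Y U : Type*} [MeasurableSpace Y] [TopologicalSpace U] [SecondCountableTopology U]

/-- By compactness, `h y` maps `K` into `V` exactly when it stays some `1/n` away from `Vᶜ`. That
closed condition can be tested on a countable dense subset of `K`. -/
theorem measurableSet_mapsTo {h : Y → C(U, ℝ)} (hm : ∀ u, Measurable fun y => h y u) {K : Set U}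
    (hK : IsCompact K) {V : Set ℝ} (hV : IsOpen V) : MeasurableSet {y | Set.MapsTo (h y) K V} := by
  obtain ⟨D, hDc, hDd⟩ := TopologicalSpace.exists_countable_dense K
  have heq : {y | Set.MapsTo (h y) K V} =
      ⋃ n : ℕ, ⋂ x ∈ D, {y | ((n : ℝ≥0∞))⁻¹ ≤ Metric.infEDist (h y x) Vᶜ} := by
    ext y
    have hcont : Continuous fun x : U => Metric.infEDist (h y x) Vᶜ :=
      Metric.continuous_infEDist.comp (h y).continuous
    simp only [Set.mem_ofPred_eq, Set.mem_iUnion, Set.mem_iInter]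
    constructor
    · intro hy
      rcases K.eq_empty_or_nonempty with rfl | hne
      · exact ⟨0, fun x => absurd x.2 (Set.notMem_empty _)⟩
      obtain ⟨x₀, hx₀, hmin⟩ := hK.exists_isMinOn hne hcont.continuousOn
      have hpos : Metric.infEDist (h y x₀) Vᶜ ≠ 0 := fun h0 =>
        (Metric.mem_iff_infEDist_zero_of_closed hV.isClosed_compl).2 h0 (hy hx₀)
      obtain ⟨n, hn⟩ := ENNReal.exists_inv_nat_lt hpos
      exact ⟨n, fun x _ => hn.le.trans (hmin x.2)⟩
    · rintro ⟨n, hn⟩ x hx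
      have hcl : IsClosed {x : K | ((n : ℝ≥0∞))⁻¹ ≤ Metric.infEDist (h y x) Vᶜ} :=
        isClosed_le continuous_const (hcont.comp continuous_subtype_val)
      have hmem : (⟨x, hx⟩ : K) ∈ {x : K | ((n : ℝ≥0∞))⁻¹ ≤ Metric.infEDist (h y x) Vᶜ} :=
        hcl.closure_subset_iff.2 hn (hDd _)
      by_contra hxV
      have h0 := Metric.infEDist_zero_of_mem (Set.mem_compl hxV)
      simp [h0] at hmem
  rw [heq]
  refine .iUnion fun n => .biInter hDc fun x _ => ?_
  exact measurableSet_le measurable_const (Metric.continuous_infEDist.measurable.comp (hm x))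

theorem stronglyMeasurable_continuousMap [LocallyCompactSpace U] {h : Y → C(U, ℝ)}
    (hm : ∀ u, Measurable fun y => h y u) : StronglyMeasurable h := by
  borelize C(U, ℝ)
  refine Measurable.stronglyMeasurable ?_
  rw [BorelSpace.measurable_eq (α := C(U, ℝ)),
    borel_eq_generateFrom_of_subbasis (α := C(U, ℝ)) ContinuousMap.compactOpen_eq]
  refine measurable_generateFrom ?_
  rintro _ ⟨K, hK, V, hV, rfl⟩
  exact measurableSet_mapsTo hm hK hV

/-- The bounded continuous functions need not be separable, but the supremum may be taken over a
countable dense set. -/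
theorem measurable_norm_boundedContinuousFunction {h : Y → U →ᵇ ℝ}
    (hm : ∀ u, Measurable fun y => h y u) : Measurable fun y => ‖h y‖ := by
  obtain ⟨D, hDc, hDd⟩ := TopologicalSpace.exists_countable_dense U
  refine measurable_of_Iic fun c => ?_
  rcases lt_or_ge c 0 with hc | hc
  · convert MeasurableSet.empty
    ext y
    simpa using hc.trans_le (norm_nonneg (h y))
  have heq : (fun y => ‖h y‖) ⁻¹' Set.Iic c = ⋂ x ∈ D, {y | ‖h y x‖ ≤ c} := by
    ext y
    simp only [Set.mem_preimage, Set.mem_Iic, Set.mem_iInter, Set.mem_ofPred_eq,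
      BoundedContinuousFunction.norm_le hc]
    refine ⟨fun hy x _ => hy x, fun hy x => ?_⟩
    have hcl : IsClosed {x | ‖h y x‖ ≤ c} :=
      isClosed_le (h y).continuous.norm continuous_const
    exact hcl.closure_subset_iff.2 hy (hDd x)
  rw [heq]
  exact .biInter hDc fun x _ => measurableSet_le (hm x).norm measurable_const

end MeasurableFunctionValued

/-! ### The feature map and the mean embedding. -/

section KernelMeanEmbedding

variable {U : Type*} {H : Type*} [NormedAddCommGroup H] [InnerProductSpace ℝ H] [CompleteSpace H]
  [RKHS ℝ H U ℝ] {k : U → U → ℝ}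

theorem inner_featureMap (u : U) (f : H) : inner ℝ (featureMap H u) f = f u := by
  simp [featureMap]

theorem inner_featureMap_featureMap (hH : IsRKHSOf H k) (u v : U) :
    inner ℝ (featureMap H u) (featureMap H v) = k u v := by
  rw [inner_featureMap, featureMap, RKHS.kerFun_apply, hH]

theorem dense_span_range_featureMap :
    Dense (Submodule.span ℝ (Set.range (featureMap H)) : Set H) := by
  have h : Submodule.span ℝ {x : H | ∃ u v, RKHS.kerFun H u v = x} ≤
      Submodule.span ℝ (Set.range (featureMap H)) := by
    rw [Submodule.span_le]
    rintro _ ⟨u, v, rfl⟩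
    have : RKHS.kerFun H u v = v • featureMap H u := by
      rw [featureMap, ← map_smul, smul_eq_mul, mul_one]
    rw [this]
    exact Submodule.smul_mem _ _ (Submodule.subset_span ⟨u, rfl⟩)
  have hd := Submodule.dense_iff_topologicalClosure_eq_top.2 (RKHS.kerFun_dense (𝕜 := ℝ) H)
  exact hd.mono h

variable [TopologicalSpace U]

theorem continuous_featureMap (hH : IsRKHSOf H k) (hk : KernelAssumption H k) :
    Continuous (featureMap H) := by
  rw [continuous_iff_continuousAt]
  intro v
  rw [ContinuousAt, tendsto_iff_norm_sub_tendsto_zero]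
  have hsq : ∀ u, ‖featureMap H u - featureMap H v‖ = √(k u u - 2 * k u v + k v v) := by
    intro u
    rw [← Real.sqrt_sq (norm_nonneg _), norm_sub_sq_real, ← real_inner_self_eq_norm_sq,
      ← real_inner_self_eq_norm_sq]
    simp only [inner_featureMap_featureMap hH]
  simp only [hsq]
  have h1 : Continuous fun u => k u u := hk.continuous.comp (continuous_id.prodMk continuous_id)
  have h2 : Continuous fun u => k u v := hk.continuous.comp (continuous_id.prodMk continuous_const)
  have h3 : Continuous fun u => √(k u u - 2 * k u v + k v v) :=
    ((h1.sub (h2.const_mul 2)).add continuous_const).sqrt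
  have h4 := h3.tendsto v
  rwa [show k v v - 2 * k v v + k v v = 0 by ring, Real.sqrt_zero] at h4

theorem exists_norm_featureMap_le (hH : IsRKHSOf H k) (hk : KernelAssumption H k) :
    ∃ C : ℝ, ∀ u, ‖featureMap H u‖ ≤ C := by
  obtain ⟨M, hM⟩ := hk.bounded
  refine ⟨√M, fun u => Real.le_sqrt_of_sq_le ?_⟩
  rw [← real_inner_self_eq_norm_sq, inner_featureMap_featureMap hH]
  exact (le_abs_self _).trans (hM u u)

variable [SecondCountableTopology U] [MeasurableSpace U] [OpensMeasurableSpace U]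

theorem stronglyMeasurable_featureMap (hH : IsRKHSOf H k) (hk : KernelAssumption H k) :
    StronglyMeasurable (featureMap H) :=
  (continuous_featureMap hH hk).stronglyMeasurable

theorem integrable_featureMap (hH : IsRKHSOf H k) (hk : KernelAssumption H k) (ν : Measure U)
    [IsFiniteMeasure ν] : Integrable (featureMap H) ν := by
  obtain ⟨C, hC⟩ := exists_norm_featureMap_le hH hk
  exact .of_bound (stronglyMeasurable_featureMap hH hk).aestronglyMeasurable C (.of_forall hC)

/-- The reproducing property under the integral; hence the fields on `H` and on `C₀(U)` agree on
common functions. -/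
theorem inner_kernelMeanEmbedding (hH : IsRKHSOf H k) (hk : KernelAssumption H k) (ν : Measure U)
    [IsFiniteMeasure ν] (f : H) : inner ℝ (kernelMeanEmbedding H ν) f = ∫ u, f u ∂ν := by
  rw [kernelMeanEmbedding, real_inner_comm, ← integral_inner (integrable_featureMap hH hk ν)]
  simp only [real_inner_comm _ f, inner_featureMap]

end KernelMeanEmbedding

/-! ### Each convergence reduced to the common condition. -/

section StochasticKernels

variable {Y U : Type*} [MeasurableSpace Y] [MeasurableSpace U] [TopologicalSpace U]

instance StochasticKernel.instIsMarkovKernel (γ : StochasticKernel Y U) : IsMarkovKernel γ.1 := γ.2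

/-- The field of functionals on `C₀(U)` given by a stochastic kernel. -/
noncomputable def StochasticKernel.functional [OpensMeasurableSpace U] (γ : StochasticKernel Y U)
    (y : Y) : C₀(U, ℝ) →L[ℝ] ℝ :=
  zeroAtInftyIntegral (γ.1 y)

theorem StochasticKernel.functional_apply [OpensMeasurableSpace U] (γ : StochasticKernel Y U)
    (y : Y) (g : C₀(U, ℝ)) : γ.functional y g = ∫ u, g u ∂(γ.1 y) := rfl

theorem StochasticKernel.norm_functional_le [OpensMeasurableSpace U] (γ : StochasticKernel Y U)
    (y : Y) : ‖γ.functional y‖ ≤ 1 :=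
  norm_zeroAtInftyIntegral_le _

theorem StochasticKernel.stronglyMeasurable_functional [OpensMeasurableSpace U]
    (γ : StochasticKernel Y U) (g : C₀(U, ℝ)) :
    StronglyMeasurable fun y => γ.functional y g :=
  StronglyMeasurable.integral_kernel (κ := γ.1) (map_continuous g).stronglyMeasurable

section Caratheodory

variable {μ : Measure Y}

theorem IsCbCaratheodory.measurable_apply {p : ℝ≥0∞} {h : Y → U →ᵇ ℝ}
    (hh : IsCbCaratheodory μ p h) (u : U) : Measurable fun y => h y u :=
  hh.1.comp (measurable_id.prodMk measurable_const)

variable [SecondCountableTopology U]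

theorem IsCbCaratheodory.integrable_norm [IsProbabilityMeasure μ] {p : ℝ≥0∞} (hp : 1 ≤ p)
    {h : Y → U →ᵇ ℝ} (hh : IsCbCaratheodory μ p h) : Integrable (fun y => ‖h y‖) μ := by
  have hm : MemLp (fun y => ‖h y‖) p μ :=
    ⟨(measurable_norm_boundedContinuousFunction hh.measurable_apply).aestronglyMeasurable, by
      rw [eLpNorm_norm]
      exact hh.2⟩
  exact hm.integrable hp

theorem IsCbCaratheodory.integrable_integral [OpensMeasurableSpace U] [IsProbabilityMeasure μ]
    {p : ℝ≥0∞} (hp : 1 ≤ p) {h : Y → U →ᵇ ℝ}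
    (hh : IsCbCaratheodory μ p h) (γ : StochasticKernel Y U) :
    Integrable (fun y => ∫ u, h y u ∂(γ.1 y)) μ := by
  refine (hh.integrable_norm hp).mono' (StronglyMeasurable.integral_kernel_prod_right'
    (κ := γ.1) hh.1.stronglyMeasurable).aestronglyMeasurable (.of_forall fun y => ?_)
  simpa using norm_integral_le_of_norm_le_const (μ := γ.1 y) (.of_forall (h y).norm_coe_le_norm)

theorem IsCbCaratheodory.integrable_cutoff [LocallyCompactSpace U] [IsProbabilityMeasure μ]
    {p : ℝ≥0∞} (hp : 1 ≤ p) {h : Y → U →ᵇ ℝ}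
    (hh : IsCbCaratheodory μ p h) {g : C(U, ℝ)} (hg : HasCompactSupport g)
    (hg1 : ∀ u, g u ∈ Set.Icc (0 : ℝ) 1) :
    Integrable (fun y => cutoff g hg (h y).toContinuousMap) μ := by
  refine (hh.integrable_norm hp).mono' ((continuous_cutoff g hg).comp_stronglyMeasurable
    (stronglyMeasurable_continuousMap hh.measurable_apply)).aestronglyMeasurable
    (.of_forall fun y => ?_)
  rw [← ZeroAtInftyContinuousMap.norm_toBCF_eq_norm,
    BoundedContinuousFunction.norm_le (norm_nonneg _)]
  intro u
  change ‖h y u * g u‖ ≤ _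
  rw [norm_mul, Real.norm_of_nonneg (hg1 u).1]
  exact (mul_le_of_le_one_right (norm_nonneg _) (hg1 u).2).trans ((h y).norm_coe_le_norm u)

end Caratheodory

variable [BorelSpace U] {μ : Measure Y}

theorem tendsto_wStarTopology_iff [IsProbabilityMeasure μ]
    {p : ℝ≥0∞} (hp : 1 ≤ p) (γseq : ℕ → StochasticKernel Y U)
    (γ : StochasticKernel Y U) :
    Tendsto γseq atTop (@nhds (StochasticKernel Y U) (wStarTopology μ p) γ) ↔
      ∀ g, SetwiseTendsto μ (fun n => (γseq n).functional) γ.functional g := by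
  rw [← forall_memLp_tendsto_iff_setwiseTendsto (C := 1)
    (fun n => (γseq n).stronglyMeasurable_functional) γ.stronglyMeasurable_functional
    (fun n => (γseq n).norm_functional_le) γ.norm_functional_le hp, tendsto_nhds_iInf_induced,
    Subtype.forall]
  rfl

section KernelMeanEmbedding

variable {H : Type*} [NormedAddCommGroup H] [InnerProductSpace ℝ H] [CompleteSpace H]
  [RKHS ℝ H U ℝ] {k : U → U → ℝ}

theorem tendsto_weakKMETopology_iff [SecondCountableTopology U] [IsProbabilityMeasure μ]
    (hH : IsRKHSOf H k) (hk : KernelAssumption H k) {p : ℝ≥0∞}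
    (hp : 1 ≤ p) (γseq : ℕ → StochasticKernel Y U) (γ : StochasticKernel Y U) :
    Tendsto γseq atTop (@nhds (StochasticKernel Y U) (weakKMETopology H μ p) γ) ↔
      ∀ g, SetwiseTendsto μ (fun n => (γseq n).functional) γ.functional g := by
  obtain ⟨C, hC⟩ := exists_norm_featureMap_le hH hk
  let T : StochasticKernel Y U → Y → H →L[ℝ] ℝ :=
    fun κ y => innerSL ℝ (kernelMeanEmbedding H (κ.1 y))
  have hTapply : ∀ κ y f, T κ y f = ∫ u, f u ∂(κ.1 y) := fun κ y f =>
    inner_kernelMeanEmbedding hH hk _ f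
  have hTm : ∀ κ f, StronglyMeasurable fun y => T κ y f := fun κ f =>
    (StronglyMeasurable.integral_kernel (κ := κ.1) (stronglyMeasurable_featureMap hH hk)).inner
      stronglyMeasurable_const
  have hTC : ∀ κ y, ‖T κ y‖ ≤ C := fun κ y => by
    have h := norm_integral_le_of_norm_le_const (μ := κ.1 y) (.of_forall hC)
    rw [probReal_univ, mul_one] at h
    exact (innerSL_apply_norm ℝ _).trans_le h
  have hcongr : ∀ (g : C₀(U, ℝ)) (f : H), (∀ u, g u = f u) →
      (SetwiseTendsto μ (fun n => (γseq n).functional) γ.functional g ↔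
        SetwiseTendsto μ (fun n => T (γseq n)) (T γ) f) := by
    intro g f hgf
    simp only [SetwiseTendsto, hTapply, StochasticKernel.functional_apply, hgf]
  have hiff : Tendsto γseq atTop (@nhds (StochasticKernel Y U) (weakKMETopology H μ p) γ) ↔
      ∀ f, SetwiseTendsto μ (fun n => T (γseq n)) (T γ) f := by
    rw [← forall_memLp_tendsto_iff_setwiseTendsto (C := C) (fun n => hTm (γseq n)) (hTm γ)
      (fun n => hTC (γseq n)) (hTC γ) hp, tendsto_nhds_iInf_induced, Subtype.forall]
    rfl
  rw [hiff]
  constructor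
  · intro h
    -- From `H` to `C₀(U)`, by density of `H` in the supremum norm.
    refine SetwiseTendsto.of_dense_span (C := 1)
      (fun n => (γseq n).stronglyMeasurable_functional) γ.stronglyMeasurable_functional
      (fun n => (γseq n).norm_functional_le) γ.norm_functional_le
      (hk.dense.mono Submodule.subset_span) ?_
    rintro g ⟨f, hf⟩
    exact (hcongr g f hf).2 (h f)
  · intro h
    -- From `C₀(U)` to `H`, by density of the span of the features.
    refine SetwiseTendsto.of_dense_span (C := C) (fun n => hTm (γseq n)) (hTm γ)
      (fun n => hTC (γseq n)) (hTC γ) dense_span_range_featureMap ?_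
    rintro _ ⟨u, rfl⟩
    obtain ⟨g, hg⟩ := hk.zeroAtInfty u
    refine (hcongr g _ fun v => ?_).1 (h g)
    rw [hg, featureMap, RKHS.kerFun_apply, hH]

end KernelMeanEmbedding

/-! ### Cutoffs and the Young narrow topology. -/

section Young

/-- Each `γ(y)` has total mass one, so dominated convergence applies over `U`, then over `Y`. -/
theorem tendsto_integral_norm_cutoff (γ : StochasticKernel Y U) {w : Y → ℝ} (hw : Integrable w μ)
    {g : ℕ → C(U, ℝ)} (hgc : ∀ n, HasCompactSupport (g n))
    (hg01 : ∀ n u, g n u ∈ Set.Icc (0 : ℝ) 1) (hg : ∀ u, ∀ᶠ n in atTop, g n u = 1) :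
    Tendsto (fun n => ∫ y, γ.functional y (w y • cutoff (g n) (hgc n) 1) ∂μ) atTop
      (𝓝 (∫ y, w y ∂μ)) := by
  have happ : ∀ n y, γ.functional y (w y • cutoff (g n) (hgc n) 1) =
      w y * ∫ u, g n u ∂(γ.1 y) := by
    intro n y
    rw [map_smul, smul_eq_mul, StochasticKernel.functional_apply]
    simp only [cutoff_apply, ContinuousMap.one_apply, one_mul]
  have hnorm : ∀ n u, ‖g n u‖ ≤ 1 := fun n u => by
    rw [Real.norm_of_nonneg (hg01 n u).1]
    exact (hg01 n u).2
  refine tendsto_integral_of_dominated_convergence (fun y => ‖w y‖) (fun n =>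
    (integrable_clm_apply γ.stronglyMeasurable_functional γ.norm_functional_le
      (hw.smul_const _)).1) hw.norm (fun n => .of_forall fun y => ?_) (.of_forall fun y => ?_)
  · rw [happ, norm_mul]
    refine mul_le_of_le_one_right (norm_nonneg _) ?_
    simpa using norm_integral_le_of_norm_le_const (μ := γ.1 y) (.of_forall (hnorm n))
  · simp only [happ]
    have h1 : Tendsto (fun n => ∫ u, g n u ∂(γ.1 y)) atTop (𝓝 (∫ _, (1 : ℝ) ∂(γ.1 y))) :=
      tendsto_integral_of_dominated_convergence (fun _ => (1 : ℝ))
        (fun n => (g n).continuous.aestronglyMeasurable) (integrable_const _)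
        (fun n => .of_forall (hnorm n))
        (.of_forall fun u => tendsto_const_nhds.congr' ((hg u).mono fun _ h => h.symm))
    simpa using h1.const_mul (w y)

variable [SecondCountableTopology U] [LocallyCompactSpace U]

/-- The error of a cutoff is controlled by the mass that the weighted kernel puts outside. -/
theorem IsCbCaratheodory.abs_integral_sub_cutoff_le [IsProbabilityMeasure μ]
    {p : ℝ≥0∞} (hp : 1 ≤ p) {h : Y → U →ᵇ ℝ}
    (hh : IsCbCaratheodory μ p h) {g : C(U, ℝ)} (hg : HasCompactSupport g)
    (hg1 : ∀ u, g u ∈ Set.Icc (0 : ℝ) 1) (γ : StochasticKernel Y U) :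
    |(∫ y, ∫ u, h y u ∂(γ.1 y) ∂μ) -
        ∫ y, γ.functional y (cutoff g hg (h y).toContinuousMap) ∂μ| ≤
      (∫ y, ‖h y‖ ∂μ) - ∫ y, γ.functional y (‖h y‖ • cutoff g hg 1) ∂μ := by
  have hf := integrable_clm_apply γ.stronglyMeasurable_functional γ.norm_functional_le
    (hh.integrable_cutoff hp hg hg1)
  have hw := integrable_clm_apply γ.stronglyMeasurable_functional γ.norm_functional_le
    ((hh.integrable_norm hp).smul_const (cutoff g hg 1))
  rw [← integral_sub (hh.integrable_integral hp γ) hf, ← integral_sub (hh.integrable_norm hp) hw,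
    ← Real.norm_eq_abs]
  refine norm_integral_le_of_norm_le ((hh.integrable_norm hp).sub hw) (.of_forall fun y => ?_)
  have hi1 := (h y).integrable (γ.1 y)
  have hi2 := integrable_zeroAtInfty (γ.1 y) (cutoff g hg (h y).toContinuousMap)
  have hi3 := integrable_zeroAtInfty (γ.1 y) (‖h y‖ • cutoff g hg 1)
  rw [StochasticKernel.functional_apply, StochasticKernel.functional_apply, ← integral_sub hi1 hi2]
  have hsub : ‖h y‖ - ∫ u, (‖h y‖ • cutoff g hg 1) u ∂(γ.1 y) =
      ∫ u, (‖h y‖ - (‖h y‖ • cutoff g hg 1) u) ∂(γ.1 y) := by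
    rw [integral_sub (integrable_const _) hi3]
    simp
  rw [hsub]
  refine norm_integral_le_of_norm_le ((integrable_const _).sub hi3) (.of_forall fun u => ?_)
  change ‖h y u - h y u * g u‖ ≤ ‖h y‖ - ‖h y‖ * (1 * g u)
  have hg2 : 0 ≤ 1 - g u := sub_nonneg.2 (hg1 u).2
  calc ‖h y u - h y u * g u‖ = ‖h y u‖ * (1 - g u) := by
        rw [← mul_one_sub, norm_mul, Real.norm_of_nonneg hg2]
    _ ≤ ‖h y‖ * (1 - g u) := by
        gcongr
        exact (h y).norm_coe_le_norm u
    _ = _ := by ring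

theorem exists_seq_cutoff (U : Type*) [TopologicalSpace U] [R1Space U] [RegularSpace U]
    [LocallyCompactSpace U] [SigmaCompactSpace U] :
    ∃ g : ℕ → C(U, ℝ), (∀ n, HasCompactSupport (g n)) ∧ (∀ n u, g n u ∈ Set.Icc (0 : ℝ) 1) ∧
      ∀ u, ∀ᶠ n in atTop, g n u = 1 := by
  let K := CompactExhaustion.choice U
  choose g hg1 _ hgc hg01 using fun n => exists_continuous_one_zero_of_isCompact (K.isCompact n)
    isClosed_empty (Set.disjoint_empty _)
  refine ⟨g, hgc, hg01, fun u => ?_⟩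
  obtain ⟨m, hm⟩ := K.exists_mem u
  filter_upwards [eventually_ge_atTop m] with n hn
  exact hg1 n (K.subset hn hm)

theorem tendsto_youngNarrowTopology_iff [TopologicalSpace.MetrizableSpace U]
    [IsProbabilityMeasure μ]
    {p : ℝ≥0∞} (hp : 1 ≤ p)
    (γseq : ℕ → StochasticKernel Y U) (γ : StochasticKernel Y U) :
    Tendsto γseq atTop (@nhds (StochasticKernel Y U) (youngNarrowTopology μ p) γ) ↔
      ∀ g, SetwiseTendsto μ (fun n => (γseq n).functional) γ.functional g := by
  rw [tendsto_nhds_iInf_induced, Subtype.forall]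
  constructor
  · intro hY g A hA
    have hcar : IsCbCaratheodory μ p (A.indicator fun _ => g.toBCF) := by
      constructor
      · have : (fun x : Y × U => A.indicator (fun _ => g.toBCF) x.1 x.2) =
            (Prod.fst ⁻¹' A).indicator fun x => g x.2 := by
          ext x
          by_cases hx : x.1 ∈ A <;> simp [hx]
        rw [this]
        exact ((map_continuous g).measurable.comp measurable_snd).indicator (measurable_fst hA)
      · exact ((memLp_const g.toBCF).indicator hA).2
    have : ∀ κ : StochasticKernel Y U, ∫ y in A, κ.functional y g ∂μ =
        ∫ y, ∫ u, A.indicator (fun _ => g.toBCF) y u ∂(κ.1 y) ∂μ := by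
      intro κ
      rw [← integral_indicator hA]
      congr with y
      by_cases hy : y ∈ A <;> simp [hy, StochasticKernel.functional_apply]
    simpa only [this] using hY _ hcar
  · intro hD h hh
    have hL : ∀ f : Y → C₀(U, ℝ), Integrable f μ →
        Tendsto (fun n => ∫ y, (γseq n).functional y (f y) ∂μ) atTop
          (𝓝 (∫ y, γ.functional y (f y) ∂μ)) := fun f hf =>
      tendsto_integral_of_setwiseTendsto (fun n => (γseq n).stronglyMeasurable_functional)
        γ.stronglyMeasurable_functional (fun n => (γseq n).norm_functional_le)
        γ.norm_functional_le hD hf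
    obtain ⟨g, hgc, hg01, hg⟩ := exists_seq_cutoff U
    have hw := hh.integrable_norm hp
    refine tendsto_of_forall_approx fun ε hε => ?_
    -- The cutoff is chosen from the limit `γ` alone.
    obtain ⟨j, hj⟩ := ((tendsto_integral_norm_cutoff γ hw hgc hg01 hg).eventually_const_lt
      (sub_lt_self (∫ y, ‖h y‖ ∂μ) hε)).exists
    refine ⟨_, _, hL _ (hh.integrable_cutoff hp (hgc j) (hg01 j)), ?_,
      (hh.abs_integral_sub_cutoff_le hp (hgc j) (hg01 j) γ).trans (by linarith)⟩
    -- With `j` fixed, the retained mass is a `C₀` pairing, so its lower bound holds for `γseq n`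
    -- eventually.
    filter_upwards [(hL _ (hw.smul_const (cutoff (g j) (hgc j) 1))).eventually_const_lt hj]
      with n hn
    exact (hh.abs_integral_sub_cutoff_le hp (hgc j) (hg01 j) (γseq n)).trans (by linarith)

end Young

end StochasticKernels

theorem theorem3p3
    {Y : Type*} [MeasurableSpace Y] [StandardBorelSpace Y]
    (μ : Measure Y) [IsProbabilityMeasure μ]
    {U : Type*} [TopologicalSpace U] [TopologicalSpace.MetrizableSpace U]
    [SecondCountableTopology U] [LocallyCompactSpace U] [MeasurableSpace U] [BorelSpace U]
    (k : U → U → ℝ)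
    (H : Type*) [NormedAddCommGroup H] [InnerProductSpace ℝ H] [CompleteSpace H] [RKHS ℝ H U ℝ]
    (hH : IsRKHSOf H k) (hk : KernelAssumption H k)
    (p₁ p₂ p₃ : ℝ≥0∞) (hp₁ : 1 ≤ p₁ ∧ p₁ ≠ ∞) (hp₂ : 1 ≤ p₂ ∧ p₂ ≠ ∞) (hp₃ : 1 ≤ p₃ ∧ p₃ ≠ ∞)
    (γseq : ℕ → StochasticKernel Y U) (γ : StochasticKernel Y U) :
    List.TFAE
      [Tendsto γseq atTop (@nhds (StochasticKernel Y U) (weakKMETopology H μ p₁) γ),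
       Tendsto γseq atTop (@nhds (StochasticKernel Y U) (wStarTopology μ p₂) γ),
       Tendsto γseq atTop (@nhds (StochasticKernel Y U) (youngNarrowTopology μ p₃) γ)] := by
  rw [tendsto_weakKMETopology_iff hH hk hp₁.1, tendsto_wStarTopology_iff hp₂.1,
    tendsto_youngNarrowTopology_iff hp₃.1]
  simp
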